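/- For a finite simple graph $G=(V,E)$, let $\mathscr D_G$ be the set of all $D\subseteq E$ no two edges of which share a vertex. For $x>0$ consider on $\mathscr D_G$ the probability measure $\mu_{G,x}(D)=x^{|V|-2|D|}/Z_G(x)$, where $Z_G(x)=\sum_{D\in\mathscr D_G}x^{|V|-2|D|}$. For $o\in V$ let $\mathcal R_x(G,o)=\mu_{G,x}(\{D:\ o\text{ is not covered by an edge of }D\})$ be the probability of a monomer at $o$. Let $\rho=(\rho_k)_{k\ge 0}$ be a probability distribution on $\mathbb N=\{0,1,2,\dots\}$ with $\sum_{k}k\,\rho_k<\infty$. Let $\mathcal T(\rho)$ be a Galton--Watson tree with root $o$ and offspring distribution $\rho$, defined on a probability space $(\Omega,\mathcal F,\mathbb P)$; that is, all vertices, including the root, have i.i.d. numbers of sons with distribution $\rho$. Let $\mathcal T(\rho,r)$ be the finite subtree induced by the vertices at distance at most $r$ from $o$. Then there are random variables $X(x)$, $x>0$, such that: 1. almost surely, for every $x>0$ simultaneously, $\lim_{r\to\infty}\mathcal R_x(\mathcal T(\rho,r),o)=X(x)$; 2. almost surely, the function $x\mapsto X(x)$ is real analytic on $(0,\infty)$;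 3. for every $x>0$, the distribution of $X(x)$ is the only probability distribution supported in $[0,1]$ that solves the distributional equation $$X\overset{\mathcal D}{=}\frac{x^2}{x^2+\sum_{i=1}^{K}X_i},$$ where $(X_i)_{i\ge1}$ are i.i.d. copies of $X$, $K$ has distribution $\rho$, and $K$ is independent of $(X_i)_{i\ge1}$. -/

import Mathlib

open Set Filter Topology MeasureTheory ProbabilityTheory
open scoped ENNReal

namespace MonomerDimer

section FiniteGraph

/-- A dimeric configuration on a graph `G`: a set of edges of `G`, no two of which have a vertex
in common. -/
def IsDimericConfig {V : Type*} (G : SimpleGraph V) (D : Finset (Sym2 V)) : Prop :=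
  (∀ e ∈ D, e ∈ G.edgeSet) ∧ ∀ e ∈ D, ∀ f ∈ D, e ≠ f → ∀ v : V, ¬ (v ∈ e ∧ v ∈ f)

/-- The monomeric configuration associated with `D`: the vertices not covered by a dimer. -/
def monomers {V : Type*} (D : Finset (Sym2 V)) : Set V :=
  {v | ∀ u : V, s(u, v) ∉ D}

open Classical in
/-- The finite set of all dimeric configurations on a finite graph. -/
noncomputable def dimericConfigs {V : Type*} [Fintype V] (G : SimpleGraph V) :
    Finset (Finset (Sym2 V)) :=
  Finset.univ.filter (IsDimericConfig G)

/-- The unnormalised weight `x ^ (|V| - 2 |D|)`; the exponent is an integer, so that the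
subtraction is the true one. -/
noncomputable def weight (V : Type*) [Fintype V] (x : ℝ) (D : Finset (Sym2 V)) : ℝ :=
  x ^ ((Fintype.card V : ℤ) - 2 * (D.card : ℤ))

/-- The partition function `Z_G(x)`. -/
noncomputable def partitionFunction {V : Type*} [Fintype V] (G : SimpleGraph V) (x : ℝ) : ℝ :=
  ∑ D ∈ dimericConfigs G, weight V x D

/-- The probability `μ_{G,x}(D)` of a dimeric configuration `D`. -/
noncomputable def gibbsProb {V : Type*} [Fintype V] (G : SimpleGraph V) (x : ℝ)
    (D : Finset (Sym2 V)) : ℝ :=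
  weight V x D / partitionFunction G x

/-- The expectation `⟨f⟩_{G,x}` of a function of the dimeric configuration. -/
noncomputable def gibbsExpect {V : Type*} [Fintype V] (G : SimpleGraph V) (x : ℝ)
    (f : Finset (Sym2 V) → ℝ) : ℝ :=
  ∑ D ∈ dimericConfigs G, f D * gibbsProb G x D

open Classical in
/-- `R_x(G, o)`: the probability of having a monomer on the vertex `o`. -/
noncomputable def monomerProb {V : Type*} [Fintype V] (G : SimpleGraph V) (x : ℝ) (o : V) : ℝ :=
  gibbsExpect G x (fun D => if o ∈ monomers D then 1 else 0)

end FiniteGraph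

section Tree

/-- The vertices of the rooted tree in which the vertex `u` has `k u` sons. Vertices are labelled
by finite words: the root is the empty word and the sons of `u` are `u ++ [i]` with `i < k u`. -/
inductive IsTreeVertex (k : List ℕ → ℕ) : List ℕ → Prop
  | root : IsTreeVertex k []
  | son (u : List ℕ) (i : ℕ) : IsTreeVertex k u → i < k u → IsTreeVertex k (u ++ [i])

/-- The father-son adjacency relation on words. -/
def wordGraph : SimpleGraph (List ℕ) where
  Adj u v := (∃ i : ℕ, v = u ++ [i]) ∨ ∃ i : ℕ, u = v ++ [i]
  symm := ⟨fun _ _ h => h.symm⟩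
  loopless := ⟨fun u h => by
    rcases h with ⟨i, h⟩ | ⟨i, h⟩ <;> simpa using congrArg List.length h⟩

/-- The vertices in the first `r` generations; the generation of a word is its length. -/
def treeVertices (k : List ℕ → ℕ) (r : ℕ) : Set (List ℕ) :=
  {v | IsTreeVertex k v ∧ v.length ≤ r}

theorem treeVertices_finite (k : List ℕ → ℕ) (r : ℕ) : (treeVertices k r).Finite := by
  induction r with
  | zero =>
    refine (Set.finite_singleton []).subset ?_
    rintro v ⟨-, hv⟩
    simpa using hv
  | succ r ih =>
    refine ((Set.finite_singleton []).union
      (ih.biUnion (fun u _ => (Set.finite_Iio (k u)).image (fun i => u ++ [i])))).subset ?_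
    rintro v ⟨hv, hl⟩
    cases hv with
    | root => exact Or.inl rfl
    | son u i hu hi =>
      refine Or.inr (Set.mem_biUnion (x := u) ⟨hu, ?_⟩ ⟨i, hi, rfl⟩)
      simpa using hl

noncomputable instance (k : List ℕ → ℕ) (r : ℕ) : Fintype (treeVertices k r) :=
  (treeVertices_finite k r).fintype

/-- The truncation at depth `r` of the tree with offspring numbers `k`: the subtree induced by
the first `r` generations. -/
def truncatedTree (k : List ℕ → ℕ) (r : ℕ) : SimpleGraph (treeVertices k r) :=
  wordGraph.induce (treeVertices k r)

/-- The root `o` of the truncated tree. -/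
def treeRoot (k : List ℕ → ℕ) (r : ℕ) : treeVertices k r :=
  ⟨[], IsTreeVertex.root, Nat.zero_le r⟩

end Tree

section GaltonWatson

/-- `K` is the family of offspring numbers of a Galton-Watson tree with offspring distribution
`ρ`: the `K v` are i.i.d. random variables with distribution `ρ`. The random tree itself, truncated
at depth `r`, is `ω ↦ truncatedTree (fun v => K v ω) r`. -/
structure IsGaltonWatsonOffspring {Ω : Type*} [MeasurableSpace Ω] (P : Measure Ω) (ρ : PMF ℕ)
    (K : List ℕ → Ω → ℕ) : Prop where
  measurable : ∀ v, Measurable (K v)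
  law : ∀ v, P.map (K v) = ρ.toMeasure
  indep : iIndepFun K P

/-- The law of `x² / (x² + ∑_{i ≤ K} X_i)`, where `K` has distribution `ρ`, the `X_i` are i.i.d.
with distribution `ν`, and `K` is independent of `(X_i)_i`: the image of the joint law
`ρ ⊗ ν^{⊗ ℕ}` of `(K, (X_i)_i)`. -/
noncomputable def recursionLaw (ρ : PMF ℕ) (x : ℝ) (ν : Measure ℝ) : Measure ℝ :=
  (ρ.toMeasure.prod (Measure.infinitePi (fun _ : ℕ => ν))).map
    (fun p : ℕ × (ℕ → ℝ) => x ^ 2 / (x ^ 2 + ∑ i ∈ Finset.range p.1, p.2 i))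

/-- `ν` is the distribution of a random variable `X`, supported in `[0,1]`, that solves the
distributional equation `X = x² / (x² + ∑_{i ≤ K} X_i)`. -/
structure IsFixedPointLaw (ρ : PMF ℕ) (x : ℝ) (ν : Measure ℝ) : Prop where
  isProbabilityMeasure : IsProbabilityMeasure ν
  supported : ∀ᵐ y ∂ν, y ∈ Icc (0 : ℝ) 1
  fixed : ν = recursionLaw ρ x ν

end GaltonWatson

end MonomerDimer

/-! Splitting the matchings of a finite graph by the state of `o` gives a recursion for the
partition function, and dividing it out turns the monomer probability into `x² / (x² + ∑ R)`, the
sum running over the neighbours of `o` in the graph without `o` (`monomerRatio_eq_div`). On a tree,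
deleting the root disconnects the subtrees of the sons, so the recursion closes
(`monomerRatio_treeFinset`).

Convergence comes from complex analysis. `R_x / x` extends holomorphically to `Re z > 0`, bounded by
`1 / Re z`. Its increments in `r` are at most the size of generation `r` times `(Re z)^(-2r)`, up to
a factor `2 / Re z`. Generation `r` has mean size `m ^ r`, where `m` is the mean of `ρ`, so almost
surely the sizes grow at most exponentially and the increments are summable for large `Re z`. A
Vitali argument carries convergence and analyticity to all `x > 0`
(`exists_analyticAt_tendsto_treeRec`). The exceptional null set does not depend on `x`.

The limit satisfies the recursion tree by tree, and the branching property `map_root_subtrees` makes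
its law a fixed point. For uniqueness, put i.i.d. marks of a fixed point law `ν` on the boundary:
the root value has law `ν` at every depth (`map_markedTreeRec`), yet it is squeezed between two
consecutive monomer probabilities (`treeRec_mem_uIcc`) and so converges to the limit already found.
-/

namespace MonomerDimer

/-! ### Partition functions of induced subgraphs and the monomer recursion. -/

section MatchingSum

open Classical in
/-- The dimeric configurations of `G` all of whose dimers lie inside the finite set `S`. -/
noncomputable def matchings {V : Type*} (G : SimpleGraph V) (S : Finset V) :
    Finset (Finset (Sym2 V)) :=
  S.sym2.powerset.filter (IsDimericConfig G)

/-- The partition function of the subgraph of `G` induced by the finite set `S`. -/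
noncomputable def matchingSum {V : Type*} (G : SimpleGraph V) (x : ℝ) (S : Finset V) : ℝ :=
  ∑ D ∈ matchings G S, x ^ ((S.card : ℤ) - 2 * (D.card : ℤ))

variable {V W : Type*} {G : SimpleGraph V} {H : SimpleGraph W} {x : ℝ}

theorem mem_matchings {S : Finset V} {D : Finset (Sym2 V)} :
    D ∈ matchings G S ↔ (∀ e ∈ D, ∀ v ∈ e, v ∈ S) ∧ IsDimericConfig G D := by
  simp [matchings, Finset.subset_iff, Finset.mem_sym2_iff]

theorem IsDimericConfig.mono {D D' : Finset (Sym2 V)} (h : IsDimericConfig G D) (hD : D' ⊆ D) :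
    IsDimericConfig G D' :=
  ⟨fun e he => h.1 e (hD he), fun e he f hf => h.2 e (hD he) f (hD hf)⟩

theorem empty_mem_matchings (S : Finset V) : ∅ ∈ matchings G S := by
  simp [mem_matchings, IsDimericConfig]

theorem matchingSum_pos (hx : 0 < x) (S : Finset V) : 0 < matchingSum G x S :=
  Finset.sum_pos (fun _ _ => zpow_pos hx _) ⟨∅, empty_mem_matchings S⟩

theorem filter_monomer_matchings [DecidableEq V] {S : Finset V} {o : V}
    [DecidablePred fun D : Finset (Sym2 V) => o ∈ monomers D] :
    (matchings G S).filter (fun D => o ∈ monomers D) = matchings G (S.erase o) := by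
  ext D
  rw [Finset.mem_filter]
  simp only [mem_matchings, monomers, Set.mem_ofPred_eq, Finset.mem_erase]
  constructor
  · rintro ⟨⟨h1, h2⟩, h3⟩
    refine ⟨fun e he v hv => ⟨?_, h1 e he v hv⟩, h2⟩
    rintro rfl
    obtain ⟨u, rfl⟩ := hv
    exact h3 u (Sym2.eq_swap ▸ he)
  · rintro ⟨h1, h2⟩
    refine ⟨⟨fun e he v hv => (h1 e he v hv).2, h2⟩, fun u hu => ?_⟩
    exact (h1 _ hu o (Sym2.mem_mk_right u o)).1 rfl

theorem sum_monomer_matchings [DecidableEq V] (hx : x ≠ 0) {S : Finset V} {o : V}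
    [DecidablePred fun D : Finset (Sym2 V) => o ∈ monomers D] (ho : o ∈ S) :
    ∑ D ∈ (matchings G S).filter (fun D => o ∈ monomers D),
      x ^ ((S.card : ℤ) - 2 * (D.card : ℤ)) = x * matchingSum G x (S.erase o) := by
  rw [filter_monomer_matchings, matchingSum, Finset.mul_sum]
  refine Finset.sum_congr rfl fun D _ => ?_
  rw [← Finset.card_erase_add_one ho, ← zpow_one_add₀ hx]
  congr 1
  push_cast
  ring

theorem isDimericConfig_insert [DecidableEq V] {D : Finset (Sym2 V)} (h : IsDimericConfig G D)
    {e : Sym2 V} (he : e ∈ G.edgeSet) (hd : ∀ f ∈ D, ∀ v ∈ f, v ∉ e) :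
    IsDimericConfig G (insert e D) := by
  refine ⟨fun f hf => ?_, fun f hf g hg hfg v hv => ?_⟩
  · rcases Finset.mem_insert.1 hf with rfl | hf
    exacts [he, h.1 f hf]
  · rcases Finset.mem_insert.1 hf with rfl | hf' <;> rcases Finset.mem_insert.1 hg with rfl | hg'
    exacts [hfg rfl, hd g hg' v hv.2 hv.1, hd f hf' v hv.1 hv.2, h.2 f hf' g hg' hfg v hv]

/-- A covered `o` has a unique partner `v`, and removing the dimer `s(o, v)` is a bijection. It
costs two vertices and one dimer, so the exponent is unchanged and no power of `x` appears. -/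
theorem sum_dimer_matchings [DecidableEq V] [DecidableRel G.Adj] {S : Finset V} {o : V}
    [DecidablePred fun D : Finset (Sym2 V) => o ∈ monomers D] (ho : o ∈ S) :
    ∑ D ∈ (matchings G S).filter (fun D => ¬ o ∈ monomers D),
      x ^ ((S.card : ℤ) - 2 * (D.card : ℤ)) =
    ∑ v ∈ S.filter (G.Adj o), matchingSum G x ((S.erase o).erase v) := by
  simp only [matchingSum]
  rw [Finset.sum_sigma']
  symm
  have avoid : ∀ {v : V} {D : Finset (Sym2 V)}, D ∈ matchings G ((S.erase o).erase v) →
      ∀ f ∈ D, ∀ w ∈ f, w ∉ s(o, v) := by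
    intro v D hD f hf w hw hwe
    have := (mem_matchings.1 hD).1 f hf w hw
    simp only [Finset.mem_erase] at this
    rcases Sym2.mem_iff.1 hwe with h | h
    exacts [this.2.1 h, this.1 h]
  have notMem : ∀ {v : V} {D : Finset (Sym2 V)}, D ∈ matchings G ((S.erase o).erase v) →
      ∀ u, s(o, u) ∉ D := by
    intro v D hD u hu
    exact avoid hD _ hu o (Sym2.mem_mk_left o u) (Sym2.mem_mk_left o v)
  refine Finset.sum_bij (fun p _ => insert s(o, p.1) p.2) ?_ ?_ ?_ ?_
  · rintro ⟨v, D⟩ hp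
    simp only [Finset.mem_sigma, Finset.mem_filter] at hp ⊢
    obtain ⟨⟨hvS, hov⟩, hD⟩ := hp
    refine ⟨mem_matchings.2 ⟨?_, isDimericConfig_insert (mem_matchings.1 hD).2 hov (avoid hD)⟩, ?_⟩
    · intro e he w hw
      rcases Finset.mem_insert.1 he with rfl | he
      · rcases Sym2.mem_iff.1 hw with rfl | rfl <;> assumption
      · exact Finset.mem_of_mem_erase (Finset.mem_of_mem_erase ((mem_matchings.1 hD).1 e he w hw))
    · intro h
      exact h v (by rw [Sym2.eq_swap]; exact Finset.mem_insert_self _ _)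
  · rintro ⟨v, D⟩ hp ⟨v', D'⟩ hp' heq
    simp only [Finset.mem_sigma, Finset.mem_filter] at hp hp' heq
    have hv : v = v' := by
      have : s(o, v) ∈ insert s(o, v') D' := heq ▸ Finset.mem_insert_self _ _
      rcases Finset.mem_insert.1 this with h | h
      · exact Sym2.congr_right.1 h
      · exact absurd h (notMem hp'.2 v)
    subst hv
    have : D = D' := by
      rw [← Finset.erase_insert (notMem hp.2 v), heq, Finset.erase_insert (notMem hp'.2 v)]
    rw [this]
  · intro D hD
    rw [Finset.mem_filter] at hD
    simp only [monomers, Set.mem_ofPred_eq, not_forall, not_not] at hD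
    obtain ⟨hD, v, hv⟩ := hD
    rw [Sym2.eq_swap] at hv
    have hD' := mem_matchings.1 hD
    refine ⟨⟨v, D.erase s(o, v)⟩, ?_, Finset.insert_erase hv⟩
    simp only [Finset.mem_sigma, Finset.mem_filter]
    refine ⟨⟨hD'.1 _ hv v (Sym2.mem_mk_right o v), hD'.2.1 _ hv⟩, mem_matchings.2 ⟨?_,
      hD'.2.mono (Finset.erase_subset _ _)⟩⟩
    intro e he w hw
    have hne := Finset.ne_of_mem_erase he
    have he := Finset.mem_of_mem_erase he
    have h1 := fun w => hD'.2.2 e he _ hv hne w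
    simp only [Finset.mem_erase]
    refine ⟨?_, ?_, hD'.1 e he w hw⟩
    · rintro rfl
      exact h1 w ⟨hw, Sym2.mem_mk_right o w⟩
    · rintro rfl
      exact h1 w ⟨hw, Sym2.mem_mk_left w v⟩
  · rintro ⟨v, D⟩ hp
    simp only [Finset.mem_sigma, Finset.mem_filter] at hp ⊢
    have hv : v ∈ S.erase o := Finset.mem_erase.2 ⟨hp.1.2.ne', hp.1.1⟩
    rw [Finset.card_insert_of_notMem (notMem hp.2 v), ← Finset.card_erase_add_one ho,
      ← Finset.card_erase_add_one hv]
    congr 1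
    push_cast
    ring

theorem matchingSum_eq_add [DecidableEq V] [DecidableRel G.Adj] (hx : x ≠ 0) {S : Finset V} {o : V} (ho : o ∈ S) :
    matchingSum G x S = x * matchingSum G x (S.erase o) +
      ∑ v ∈ S.filter (G.Adj o), matchingSum G x ((S.erase o).erase v) := by
  classical
  rw [← sum_monomer_matchings hx ho, ← sum_dimer_matchings ho, Finset.sum_filter_add_sum_filter_not,
    matchingSum]

theorem matchingSum_union [DecidableEq V] (hx : x ≠ 0) {S T : Finset V} (hST : Disjoint S T)
    (hG : ∀ a ∈ S, ∀ b ∈ T, ¬ G.Adj a b) :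
    matchingSum G x (S ∪ T) = matchingSum G x S * matchingSum G x T := by
  simp only [matchingSum]
  rw [Finset.sum_mul_sum, ← Finset.sum_product']
  symm
  have hdis : ∀ a, a ∈ S → a ∉ T := fun a ha => Finset.disjoint_left.1 hST ha
  have key : ∀ D ∈ matchings G S, ∀ E ∈ matchings G T, ∀ e ∈ D, ∀ f ∈ E, ∀ v, v ∈ e → v ∉ f :=
    fun D hD E hE e he f hf v hv hv' =>
      hdis v ((mem_matchings.1 hD).1 e he v hv) ((mem_matchings.1 hE).1 f hf v hv')
  have key' : ∀ D ∈ matchings G S, ∀ E ∈ matchings G T, Disjoint D E := by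
    intro D hD E hE
    rw [Finset.disjoint_left]
    intro e he he'
    exact key D hD E hE e he e he' _ e.out_fst_mem e.out_fst_mem
  refine Finset.sum_bij' (fun p _ => p.1 ∪ p.2)
    (fun D _ => (D.filter (· ∈ S.sym2), D.filter (· ∈ T.sym2))) ?_ ?_ ?_ ?_ ?_
  · rintro ⟨D, E⟩ hp
    obtain ⟨hD, hE⟩ := Finset.mem_product.1 hp
    have hD' := mem_matchings.1 hD
    have hE' := mem_matchings.1 hE
    refine mem_matchings.2 ⟨?_, ?_, ?_⟩
    · intro e he v hv
      rcases Finset.mem_union.1 he with he | he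
      · exact Finset.mem_union_left _ (hD'.1 e he v hv)
      · exact Finset.mem_union_right _ (hE'.1 e he v hv)
    · intro e he
      rcases Finset.mem_union.1 he with he | he
      exacts [hD'.2.1 e he, hE'.2.1 e he]
    · intro e he f hf hef v hv
      rcases Finset.mem_union.1 he with he | he <;> rcases Finset.mem_union.1 hf with hf | hf
      · exact hD'.2.2 e he f hf hef v hv
      · exact key D hD E hE e he f hf v hv.1 hv.2
      · exact key D hD E hE f hf e he v hv.2 hv.1
      · exact hE'.2.2 e he f hf hef v hv
  · intro D hD
    have hD' := mem_matchings.1 hD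
    refine Finset.mem_product.2 ⟨mem_matchings.2 ⟨?_, hD'.2.mono (Finset.filter_subset _ _)⟩,
      mem_matchings.2 ⟨?_, hD'.2.mono (Finset.filter_subset _ _)⟩⟩ <;>
    · intro e he
      exact Finset.mem_sym2_iff.1 (Finset.mem_filter.1 he).2
  · rintro ⟨D, E⟩ hp
    obtain ⟨hD, hE⟩ := Finset.mem_product.1 hp
    have hD' := (mem_matchings.1 hD).1
    have hE' := (mem_matchings.1 hE).1
    refine Prod.ext ?_ ?_ <;> ext e <;>
      simp only [Finset.mem_filter, Finset.mem_union, Finset.mem_sym2_iff]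
    · refine ⟨fun h => h.1.resolve_right fun he => ?_, fun he => ⟨Or.inl he, hD' e he⟩⟩
      exact hdis _ (h.2 _ e.out_fst_mem) (hE' e he _ e.out_fst_mem)
    · refine ⟨fun h => h.1.resolve_left fun he => ?_, fun he => ⟨Or.inr he, hE' e he⟩⟩
      exact hdis _ (hD' e he _ e.out_fst_mem) (h.2 _ e.out_fst_mem)
  · intro D hD
    have hD' := mem_matchings.1 hD
    ext e
    simp only [Finset.mem_filter, Finset.mem_union, Finset.mem_sym2_iff]
    refine ⟨fun h => h.elim And.left And.left, fun he => ?_⟩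
    have h1 := hD'.1 e he
    have h2 := hD'.2.1 e he
    induction e with
    | _ a b =>
      simp only [Sym2.mem_iff, forall_eq_or_imp, forall_eq, Finset.mem_union,
        SimpleGraph.mem_edgeSet] at h1 h2 ⊢
      have h3 := hG a
      have h4 := hG b
      have h5 := h2.symm
      tauto
  · rintro ⟨D, E⟩ hp
    obtain ⟨hD, hE⟩ := Finset.mem_product.1 hp
    simp only
    rw [Finset.card_union_of_disjoint hST, Finset.card_union_of_disjoint (key' D hD E hE),
      ← zpow_add₀ hx]
    congr 1
    push_cast
    ring

theorem isDimericConfig_map (f : V ↪ W) (hf : ∀ a b, H.Adj (f a) (f b) ↔ G.Adj a b)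
    (D : Finset (Sym2 V)) :
    IsDimericConfig H (D.map f.sym2Map) ↔ IsDimericConfig G D := by
  have hmem : ∀ (e : Sym2 V) (w : W), w ∈ f.sym2Map e ↔ ∃ v ∈ e, f v = w := by
    intro e w
    simp [Function.Embedding.sym2Map, Sym2.mem_map]
  have hedge : ∀ e : Sym2 V, f.sym2Map e ∈ H.edgeSet ↔ e ∈ G.edgeSet := by
    intro e
    induction e with
    | _ a b => simp [Function.Embedding.sym2Map, hf]
  simp only [IsDimericConfig, Finset.forall_mem_map, hedge, ne_eq, EmbeddingLike.apply_eq_iff_eq]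
  refine and_congr Iff.rfl (forall₄_congr fun e he g hg => forall_congr' fun _ => ?_)
  constructor
  · intro h v hv
    exact h (f v) ⟨(hmem _ _).2 ⟨v, hv.1, rfl⟩, (hmem _ _).2 ⟨v, hv.2, rfl⟩⟩
  · rintro h w ⟨h1, h2⟩
    obtain ⟨v, hv, rfl⟩ := (hmem _ _).1 h1
    obtain ⟨v', hv', hvv⟩ := (hmem _ _).1 h2
    rw [f.injective hvv] at hv'
    exact h v ⟨hv, hv'⟩

theorem matchingSum_map (f : V ↪ W) (hf : ∀ a b, H.Adj (f a) (f b) ↔ G.Adj a b) (S : Finset V) :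
    matchingSum H x (S.map f) = matchingSum G x S := by
  have : matchings H (S.map f) =
      (matchings G S).map (Finset.mapEmbedding f.sym2Map).toEmbedding := by
    ext D
    simp only [matchings, Finset.mem_filter, Finset.mem_powerset, Finset.sym2_map, Finset.mem_map,
      Finset.subset_map_iff]
    constructor
    · rintro ⟨⟨E, hE, rfl⟩, hD⟩
      exact ⟨E, ⟨hE, (isDimericConfig_map f hf E).1 hD⟩, rfl⟩
    · rintro ⟨E, ⟨hE, hD⟩, rfl⟩
      exact ⟨⟨E, hE, rfl⟩, (isDimericConfig_map f hf E).2 hD⟩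
  simp [matchingSum, this, Finset.mapEmbedding_apply]

/-- The monomer probability at `o` in the subgraph of `G` induced by the finite set `S`. -/
noncomputable def monomerRatio [DecidableEq V] (G : SimpleGraph V) (x : ℝ) (S : Finset V) (o : V) :
    ℝ :=
  x * matchingSum G x (S.erase o) / matchingSum G x S

theorem monomerProb_eq_monomerRatio [Fintype V] [DecidableEq V] (hx : x ≠ 0) (o : V) :
    monomerProb G x o = monomerRatio G x Finset.univ o := by
  classical
  have hconf : dimericConfigs G = matchings G Finset.univ := by
    ext D
    simp [dimericConfigs, mem_matchings]
  have hZ : partitionFunction G x = matchingSum G x Finset.univ := by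
    simp [partitionFunction, matchingSum, hconf, weight]
  rw [monomerRatio]
  rw [← sum_monomer_matchings hx (Finset.mem_univ o), Finset.sum_div, Finset.sum_filter,
    monomerProb, gibbsExpect, hconf]
  refine Finset.sum_congr rfl fun D _ => ?_
  simp [gibbsProb, hZ, weight]

theorem monomerRatio_map [DecidableEq V] [DecidableEq W] (f : V ↪ W)
    (hf : ∀ a b, H.Adj (f a) (f b) ↔ G.Adj a b) (S : Finset V) (o : V) :
    monomerRatio H x (S.map f) (f o) = monomerRatio G x S o := by
  rw [monomerRatio, monomerRatio, ← Finset.map_erase, matchingSum_map f hf, matchingSum_map f hf]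

/-- With no edge between `S` and `T` the partition function factors, and the factor of `T` cancels
in the ratio. -/
theorem monomerRatio_union [DecidableEq V] (hx : 0 < x) {S T : Finset V} (hST : Disjoint S T)
    (hG : ∀ a ∈ S, ∀ b ∈ T, ¬ G.Adj a b) {o : V} (ho : o ∈ S) :
    monomerRatio G x (S ∪ T) o = monomerRatio G x S o := by
  classical
  have hoT : o ∉ T := Finset.disjoint_left.1 hST ho
  have h1 : (S ∪ T).erase o = S.erase o ∪ T := by
    rw [Finset.erase_union_distrib, Finset.erase_eq_of_notMem hoT]
  have h2 := matchingSum_union (G := G) hx.ne' hST hG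
  have h3 := matchingSum_union (G := G) hx.ne' (S := S.erase o) (T := T)
    (hST.mono_left (Finset.erase_subset _ _))
    (fun a ha => hG a (Finset.mem_of_mem_erase ha))
  have hT := (matchingSum_pos (G := G) hx T).ne'
  rw [monomerRatio, monomerRatio, h1]
  rw [h2, h3, ← mul_assoc,
    mul_div_mul_right _ _ hT]

theorem monomerRatio_eq_div [DecidableEq V] [DecidableRel G.Adj] (hx : 0 < x) {S : Finset V}
    {o : V} (ho : o ∈ S) :
    monomerRatio G x S o =
      x ^ 2 / (x ^ 2 + ∑ v ∈ S.filter (G.Adj o), monomerRatio G x (S.erase o) v) := by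
  have h := matchingSum_eq_add (G := G) hx.ne' ho
  have hZ := matchingSum_pos (G := G) hx (S.erase o)
  have hS := matchingSum_pos (G := G) hx S
  simp only [monomerRatio]
  rw [← Finset.sum_div, ← Finset.mul_sum]
  set Z := matchingSum G x (S.erase o)
  set Q := ∑ v ∈ S.filter (G.Adj o), matchingSum G x ((S.erase o).erase v)
  rw [h] at hS ⊢
  -- The ratio `x Z / (x Z + Q)` is expanded by `x / Z`.
  have h2 : x ^ 2 + x * Q / Z = x * (x * Z + Q) / Z := by field_simp
  rw [h2]
  field_simp

end MatchingSum

/-! ### The recursion on truncated trees and its dependence on boundary values. -/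

section TreeRecursion

/-- The subtree hanging from the son `i` of the root, or any labelling of its vertices. -/
def subtree {α : Type*} (k : List ℕ → α) (i : ℕ) : List ℕ → α := fun v => k (i :: v)

/-- The value at the root of the monomer recursion on the tree `k` truncated at depth `r`, with
boundary values `y` on the generation `r`. -/
noncomputable def treeRec (x : ℝ) : ℕ → (List ℕ → ℕ) → (List ℕ → ℝ) → ℝ
  | 0, _, y => y []
  | r + 1, k, y =>
    x ^ 2 / (x ^ 2 + ∑ i ∈ Finset.range (k []), treeRec x r (subtree k i) (subtree y i))

/-- Words grow at their end in `IsTreeVertex`, while the recursion strips their first letter; this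
reconciles the two. -/
theorem isTreeVertex_cons {k : List ℕ → ℕ} {i : ℕ} {v : List ℕ} :
    IsTreeVertex k (i :: v) ↔ i < k [] ∧ IsTreeVertex (subtree k i) v := by
  constructor
  · intro h
    generalize hw : i :: v = w at h
    induction h generalizing v with
    | root => simp at hw
    | son u j hu hj ih =>
      rcases u with _ | ⟨a, u⟩
      · obtain ⟨rfl, rfl⟩ : i = j ∧ v = [] := by simpa using hw
        exact ⟨hj, .root⟩
      · obtain ⟨rfl, rfl⟩ : i = a ∧ v = u ++ [j] := by simpa using hw
        exact ⟨(ih rfl).1, .son u j (ih rfl).2 hj⟩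
  · rintro ⟨hi, h⟩
    induction h with
    | root => exact IsTreeVertex.son [] i .root hi
    | son u j hu hj ih => exact IsTreeVertex.son (i :: u) j ih hj

theorem wordGraph_adj_cons {i : ℕ} {u v : List ℕ} :
    wordGraph.Adj (i :: u) (i :: v) ↔ wordGraph.Adj u v := by
  simp [wordGraph]

theorem wordGraph_adj_nil {v : List ℕ} : wordGraph.Adj [] v ↔ ∃ i, v = [i] := by
  simp [wordGraph]

theorem eq_of_wordGraph_adj_cons {i j : ℕ} {u v : List ℕ} (h : wordGraph.Adj (i :: u) (j :: v)) :
    i = j := by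
  rcases h with ⟨a, h⟩ | ⟨a, h⟩ <;> simp at h <;> simp [h.1]

/-- The vertices of the first `r` generations, as a finite set of words. -/
noncomputable def treeFinset (k : List ℕ → ℕ) (r : ℕ) : Finset (List ℕ) :=
  (treeVertices_finite k r).toFinset

theorem mem_treeFinset {k : List ℕ → ℕ} {r : ℕ} {v : List ℕ} :
    v ∈ treeFinset k r ↔ IsTreeVertex k v ∧ v.length ≤ r := by
  simp [treeFinset, treeVertices]

/-- Transport along the inclusion makes all truncations finite subsets of the single graph
`wordGraph`. -/
theorem monomerProb_truncatedTree {x : ℝ} (hx : 0 < x) (k : List ℕ → ℕ) (r : ℕ) :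
    monomerProb (truncatedTree k r) x (treeRoot k r) =
      monomerRatio wordGraph x (treeFinset k r) [] := by
  classical
  rw [monomerProb_eq_monomerRatio hx.ne',
    ← monomerRatio_map (H := wordGraph) (Function.Embedding.subtype _) (fun a b => Iff.rfl)]
  congr 1

theorem monomerRatio_sonSubtree {x : ℝ} (hx : 0 < x) (k : List ℕ → ℕ) (r : ℕ) {i : ℕ}
    (hi : i < k []) :
    monomerRatio wordGraph x ((treeFinset k (r + 1)).erase []) [i] =
      monomerRatio wordGraph x (treeFinset (subtree k i) r) [] := by
  classical
  let f : List ℕ ↪ List ℕ := ⟨List.cons i, List.cons_injective⟩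
  -- `T` collects the subtrees of the other sons; without the root it is not joined to the subtree
  -- of `i`.
  let T := ((treeFinset k (r + 1)).erase []).filter fun v => ∀ u, v ≠ i :: u
  have hmap : ∀ v, v ∈ (treeFinset (subtree k i) r).map f ↔
      v ∈ treeFinset k (r + 1) ∧ ∃ u, v = i :: u := by
    intro v
    simp only [Finset.mem_map, mem_treeFinset, f, Function.Embedding.coeFn_mk]
    constructor
    · rintro ⟨u, ⟨h1, h2⟩, rfl⟩
      exact ⟨⟨isTreeVertex_cons.2 ⟨hi, h1⟩, by simpa using h2⟩, u, rfl⟩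
    · rintro ⟨⟨h1, h2⟩, u, rfl⟩
      exact ⟨u, ⟨(isTreeVertex_cons.1 h1).2, by simpa using h2⟩, rfl⟩
  have hunion : (treeFinset k (r + 1)).erase [] = (treeFinset (subtree k i) r).map f ∪ T := by
    ext v
    rw [Finset.mem_union, hmap]
    simp only [T, Finset.mem_filter, Finset.mem_erase]
    constructor
    · rintro ⟨h1, h2⟩
      by_cases h : ∃ u, v = i :: u
      · exact Or.inl ⟨h2, h⟩
      · exact Or.inr ⟨⟨h1, h2⟩, not_exists.1 h⟩
    · rintro (⟨h1, u, rfl⟩ | h)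
      · exact ⟨by simp, h1⟩
      · exact h.1
  have hdisj : Disjoint ((treeFinset (subtree k i) r).map f) T := by
    rw [Finset.disjoint_left]
    intro v hv hT
    obtain ⟨-, u, rfl⟩ := (hmap v).1 hv
    exact (Finset.mem_filter.1 hT).2 u rfl
  have hadj : ∀ a ∈ (treeFinset (subtree k i) r).map f, ∀ b ∈ T, ¬ wordGraph.Adj a b := by
    intro a ha b hb hab
    obtain ⟨-, u, rfl⟩ := (hmap a).1 ha
    simp only [T, Finset.mem_filter, Finset.mem_erase] at hb
    rcases b with _ | ⟨j, v⟩
    · exact hb.1.1 rfl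
    · obtain rfl := eq_of_wordGraph_adj_cons hab
      exact hb.2 v rfl
  have hroot : [i] ∈ (treeFinset (subtree k i) r).map f :=
    Finset.mem_map_of_mem f (mem_treeFinset.2 ⟨.root, Nat.zero_le r⟩)
  rw [hunion, monomerRatio_union hx hdisj hadj hroot]
  exact monomerRatio_map f (fun a b => wordGraph_adj_cons) _ []

theorem monomerRatio_treeFinset {x : ℝ} (hx : 0 < x) (r : ℕ) (k : List ℕ → ℕ) :
    monomerRatio wordGraph x (treeFinset k r) [] = treeRec x r k 1 := by
  classical
  have hroot : ∀ r k, [] ∈ treeFinset k r := fun r k => mem_treeFinset.2 ⟨.root, Nat.zero_le r⟩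
  induction r generalizing k with
  | zero =>
    rw [monomerRatio_eq_div hx (hroot 0 k)]
    have : (treeFinset k 0).filter (wordGraph.Adj []) = ∅ := by
      refine Finset.filter_eq_empty_iff.2 fun v hv h => ?_
      obtain ⟨i, rfl⟩ := wordGraph_adj_nil.1 h
      simpa using (mem_treeFinset.1 hv).2
    simp [this, treeRec, hx.ne']
  | succ r ih =>
    rw [monomerRatio_eq_div hx (hroot _ k), treeRec]
    have hfilter : (treeFinset k (r + 1)).filter (wordGraph.Adj []) =
        (Finset.range (k [])).map ⟨fun i => [i], List.singleton_injective⟩ := by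
      ext v
      simp only [Finset.mem_filter, wordGraph_adj_nil, mem_treeFinset, Finset.mem_map,
        Finset.mem_range, Function.Embedding.coeFn_mk]
      constructor
      · rintro ⟨⟨h1, -⟩, i, rfl⟩
        exact ⟨i, (isTreeVertex_cons.1 h1).1, rfl⟩
      · rintro ⟨i, hi, rfl⟩
        exact ⟨⟨isTreeVertex_cons.2 ⟨hi, .root⟩, by simp⟩, i, rfl⟩
    rw [hfilter, Finset.sum_map]
    congr 2
    refine Finset.sum_congr rfl fun i hi => ?_
    exact (monomerRatio_sonSubtree hx k r (Finset.mem_range.1 hi)).trans (ih _)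

theorem treeRec_nonneg {x : ℝ} (r : ℕ) (k : List ℕ → ℕ) {y : List ℕ → ℝ} (hy : 0 ≤ y) :
    0 ≤ treeRec x r k y := by
  induction r generalizing k y with
  | zero => exact hy []
  | succ r ih =>
    rw [treeRec]
    have := Finset.sum_nonneg fun i (_ : i ∈ Finset.range (k [])) =>
      ih (subtree k i) (y := subtree y i) fun v => hy (i :: v)
    positivity

theorem treeRec_succ_le_one {x : ℝ} (r : ℕ) (k : List ℕ → ℕ) {y : List ℕ → ℝ} (hy : 0 ≤ y) :
    treeRec x (r + 1) k y ≤ 1 := by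
  rw [treeRec]
  have := Finset.sum_nonneg fun i (_ : i ∈ Finset.range (k [])) =>
    treeRec_nonneg (x := x) r (subtree k i) (y := subtree y i) fun v => hy (i :: v)
  exact div_le_one_of_le₀ (by linarith) (by positivity)

theorem treeRec_one_mem_Icc {x : ℝ} (r : ℕ) (k : List ℕ → ℕ) : treeRec x r k 1 ∈ Icc (0 : ℝ) 1 := by
  refine ⟨treeRec_nonneg r k zero_le_one, ?_⟩
  cases r with
  | zero => simp [treeRec]
  | succ r => exact treeRec_succ_le_one r k zero_le_one

/-- Each level of the recursion is decreasing in the values below it, so the direction alternates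
with the depth. -/
theorem treeRec_mono {x : ℝ} (hx : 0 < x) (r : ℕ) (k : List ℕ → ℕ) {y z : List ℕ → ℝ}
    (hy : 0 ≤ y) (hyz : y ≤ z) :
    (Even r → treeRec x r k y ≤ treeRec x r k z) ∧
      (Odd r → treeRec x r k z ≤ treeRec x r k y) := by
  induction r generalizing k y z with
  | zero => exact ⟨fun _ => hyz [], fun h => by simp at h⟩
  | succ r ih =>
    have hy' : ∀ i, 0 ≤ subtree y i := fun i v => hy (i :: v)
    have hz' : ∀ i, 0 ≤ subtree z i := fun i v => (hy (i :: v)).trans (hyz (i :: v))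
    have h' : ∀ i, subtree y i ≤ subtree z i := fun i v => hyz (i :: v)
    have hsy := Finset.sum_nonneg fun i (_ : i ∈ Finset.range (k [])) =>
      treeRec_nonneg (x := x) r (subtree k i) (hy' i)
    have hsz := Finset.sum_nonneg fun i (_ : i ∈ Finset.range (k [])) =>
      treeRec_nonneg (x := x) r (subtree k i) (hz' i)
    rw [treeRec, treeRec, Nat.even_add_one, Nat.odd_add_one, Nat.not_even_iff_odd,
      Nat.not_odd_iff_even]
    refine ⟨fun hr => ?_, fun hr => ?_⟩
    · have := Finset.sum_le_sum fun i (_ : i ∈ Finset.range (k [])) =>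
        (ih (subtree k i) (hy' i) (h' i)).2 hr
      gcongr
    · have := Finset.sum_le_sum fun i (_ : i ∈ Finset.range (k [])) =>
        (ih (subtree k i) (hy' i) (h' i)).1 hr
      gcongr

/-- A last generation with value `0` adds nothing to the sums, so every vertex just above it gets
`x² / x² = 1`. -/
theorem treeRec_zero_succ {x : ℝ} (hx : 0 < x) (r : ℕ) (k : List ℕ → ℕ) :
    treeRec x (r + 1) k 0 = treeRec x r k 1 := by
  induction r generalizing k with
  | zero => simp [treeRec, subtree, hx.ne']
  | succ r ih =>
    rw [treeRec, treeRec]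
    exact congrArg (fun s => x ^ 2 / (x ^ 2 + s)) (Finset.sum_congr rfl fun i _ => ih _)

/-- By monotonicity the extremes are the boundary values `0` and `1`, and `0` at depth `r + 1` is
`1` at depth `r`. The parity of the depth decides which end is larger. -/
theorem treeRec_mem_uIcc {x : ℝ} (hx : 0 < x) (r : ℕ) (k : List ℕ → ℕ) {y : List ℕ → ℝ}
    (hy0 : 0 ≤ y) (hy1 : y ≤ 1) :
    treeRec x (r + 1) k y ∈ uIcc (treeRec x r k 1) (treeRec x (r + 1) k 1) := by
  have h0 := treeRec_mono hx (r + 1) k le_rfl hy0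
  have h1 := treeRec_mono hx (r + 1) k hy0 hy1
  rw [treeRec_zero_succ hx] at h0
  rcases Nat.even_or_odd (r + 1) with h | h
  · exact mem_uIcc.2 (Or.inl ⟨h0.1 h, h1.1 h⟩)
  · exact mem_uIcc.2 (Or.inr ⟨h1.2 h, h0.2 h⟩)

end TreeRecursion

/-! ### A Vitali theorem on discs. -/

section Vitali

/-- A form of Vitali's theorem: a uniformly bounded sequence of holomorphic functions on a disc
whose increments are uniformly summable on a smaller concentric disc converges on the whole disc,
to a holomorphic function. -/
theorem exists_analyticOnNhd_tendsto {f : ℕ → ℂ → ℂ} {c : ℂ} {s R M : ℝ} {u : ℕ → ℝ} (hs : 0 < s)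
    (hsR : s < R) (hf : ∀ n, DifferentiableOn ℂ (f n) (Metric.ball c R))
    (hM : ∀ n, ∀ z ∈ Metric.ball c R, ‖f n z‖ ≤ M) (hu : Summable u)
    (hfu : ∀ n, ∀ z ∈ Metric.closedBall c s, ‖f (n + 1) z - f n z‖ ≤ u n) :
    ∃ F : ℂ → ℂ, AnalyticOnNhd ℂ F (Metric.ball c R) ∧
      ∀ z ∈ Metric.ball c R, Tendsto (fun n => f n z) atTop (𝓝 (F z)) := by
  have hR : 0 < R := hs.trans hsR
  have hdiff : ∀ t < R, ∀ n, DifferentiableOn ℂ (f n) (Metric.closedBall c t) := fun t ht n =>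
    (hf n).mono (Metric.closedBall_subset_ball ht)
  have hM0 : 0 ≤ M := (norm_nonneg _).trans (hM 0 c (Metric.mem_ball_self hR))
  have hcont : ∀ n m, ContDiffAt ℂ m (f n) c := fun n m =>
    ((hf n).analyticAt (Metric.ball_mem_nhds c hR)).contDiffAt
  have hbound : ∀ t, 0 < t → t < R → ∀ n m, ‖iteratedDeriv m (f n) c‖ ≤ m.factorial * M / t ^ m :=
    fun t ht0 ht n m => Complex.norm_iteratedDeriv_le_of_forall_mem_sphere_norm_le m ht0
      ((hdiff t ht n).diffContOnCl_ball Subset.rfl)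
      fun z hz => hM n z (Metric.closedBall_subset_ball ht (Metric.sphere_subset_closedBall hz))
  -- Cauchy's estimate on the small circle turns summable increments into convergence of every
  -- Taylor coefficient at `c`.
  have hcauchy : ∀ m, CauchySeq fun n => iteratedDeriv m (f n) c := by
    intro m
    refine cauchySeq_of_dist_le_of_summable (fun n => m.factorial * u n / s ^ m) (fun n => ?_)
      ((hu.mul_left _).div_const _)
    rw [dist_comm, dist_eq_norm, ← iteratedDeriv_fun_sub (hcont _ _) (hcont _ _)]
    exact Complex.norm_iteratedDeriv_le_of_forall_mem_sphere_norm_le m hs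
      (((hdiff s hsR (n + 1)).sub (hdiff s hsR n)).diffContOnCl_ball Subset.rfl)
      fun z hz => hfu n z (Metric.sphere_subset_closedBall hz)
  choose b hb using fun m => cauchySeq_tendsto_of_complete (hcauchy m)
  have hbb : ∀ t, 0 < t → t < R → ∀ m, ‖b m‖ ≤ m.factorial * M / t ^ m := fun t ht0 ht m =>
    le_of_tendsto (hb m).norm (Eventually.of_forall fun n => hbound t ht0 ht n m)
  have hterm : ∀ (t t' : ℝ), 0 < t → ∀ (m : ℕ) (z a : ℂ), z ∈ Metric.ball c t' →
      ‖a‖ ≤ m.factorial * M / t ^ m →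
      ‖(m.factorial : ℂ)⁻¹ * a * (z - c) ^ m‖ ≤ M * (t' / t) ^ m := by
    intro t t' ht m z a hz ha
    have hz' : ‖z - c‖ ≤ t' := (mem_ball_iff_norm.1 hz).le
    have hfac : (0 : ℝ) < m.factorial := by exact_mod_cast m.factorial_pos
    rw [norm_mul, norm_mul, norm_inv, norm_pow, Complex.norm_natCast]
    calc (m.factorial : ℝ)⁻¹ * ‖a‖ * ‖z - c‖ ^ m
        ≤ (m.factorial : ℝ)⁻¹ * (m.factorial * M / t ^ m) * t' ^ m := by gcongr
      _ = M * (t' / t) ^ m := by rw [div_pow]; field_simp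
  have hsummable : ∀ t' t : ℝ, 0 < t' → t' < t → Summable fun m : ℕ => M * (t' / t) ^ m :=
    fun t' t h0 h => (summable_geometric_of_lt_one (div_nonneg h0.le (h0.trans h).le)
      ((div_lt_one (h0.trans h)).2 h)).mul_left M
  -- Two radii are needed: Cauchy's estimate at `t` against `|z - c| < t'` dominates the Taylor
  -- series by a geometric one of ratio `t' / t`, uniformly in `n`.
  have hbetween : ∀ z ∈ Metric.ball c R, ∃ t' t : ℝ, 0 < t' ∧ t' < t ∧ t < R ∧
      z ∈ Metric.ball c t' := by
    intro z hz
    obtain ⟨t', h1, h2⟩ := exists_between (Metric.mem_ball.1 hz)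
    obtain ⟨t, h3, h4⟩ := exists_between h2
    exact ⟨t', t, dist_nonneg.trans_lt h1, h3, h4, h1⟩
  refine ⟨fun z => ∑' m : ℕ, (m.factorial : ℂ)⁻¹ * b m * (z - c) ^ m, ?_, ?_⟩
  · intro z hz
    obtain ⟨t', t, h0, h1, h2, h3⟩ := hbetween z hz
    refine DifferentiableOn.analyticAt (s := Metric.ball c t') ?_ (Metric.isOpen_ball.mem_nhds h3)
    refine Complex.differentiableOn_tsum_of_summable_norm (hsummable t' t h0 h1)
      (fun m => by fun_prop) Metric.isOpen_ball fun m w hw => ?_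
    exact hterm t t' (h0.trans h1) m w _ hw (hbb t (h0.trans h1) h2 m)
  · intro z hz
    obtain ⟨t', t, h0, h1, h2, h3⟩ := hbetween z hz
    have : ∀ n, f n z = ∑' m : ℕ, (m.factorial : ℂ)⁻¹ * iteratedDeriv m (f n) c * (z - c) ^ m :=
      fun n => (Complex.taylorSeries_eq_on_ball' hz (hf n)).symm
    simp_rw [this]
    refine tendsto_tsum_of_dominated_convergence (hsummable t' t h0 h1) (fun m => ?_)
      (Eventually.of_forall fun n m => ?_)
    · exact ((hb m).const_mul _).mul_const _
    · exact hterm t t' (h0.trans h1) m z _ h3 (hbound t (h0.trans h1) h2 n m)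

end Vitali

/-! ### Holomorphic extension to the right half-plane and convergence for all `x > 0`. -/

section Resolvent

/-- The size of the generation `r` of the tree `k`. -/
def generationSize : ℕ → (List ℕ → ℕ) → ℕ
  | 0, _ => 1
  | r + 1, k => ∑ i ∈ Finset.range (k []), generationSize r (subtree k i)

/-- The holomorphic extension to the right half-plane of `R_x / x` on the truncated trees. -/
noncomputable def treeResolvent (z : ℂ) : ℕ → (List ℕ → ℕ) → ℂ
  | 0, _ => z⁻¹
  | r + 1, k => (z + ∑ i ∈ Finset.range (k []), treeResolvent z r (subtree k i))⁻¹

theorem ofReal_treeRec {x : ℝ} (hx : 0 < x) (r : ℕ) (k : List ℕ → ℕ) :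
    ((treeRec x r k 1 : ℝ) : ℂ) = x * treeResolvent x r k := by
  have hx' : (x : ℂ) ≠ 0 := by exact_mod_cast hx.ne'
  induction r generalizing k with
  | zero => simp [treeRec, treeResolvent, hx']
  | succ r ih =>
    rw [treeRec, treeResolvent]
    push_cast
    have : ∀ i, ((treeRec x r (subtree k i) (subtree 1 i) : ℝ) : ℂ) =
      x * treeResolvent x r (subtree k i) := fun i => ih _
    simp_rw [this, ← Finset.mul_sum]
    rw [pow_two, ← mul_add, mul_div_mul_left _ _ hx', div_eq_mul_inv]

/-- Numbers with nonnegative real part are stable under sums and inversion. Hence every denominator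
has real part at least `z.re`, which gives both holomorphy and the uniform bound. -/
theorem treeResolvent_re_nonneg {z : ℂ} (hz : 0 < z.re) (r : ℕ) (k : List ℕ → ℕ) :
    0 ≤ (treeResolvent z r k).re := by
  induction r generalizing k with
  | zero =>
    rw [treeResolvent, Complex.inv_re]
    exact div_nonneg hz.le (Complex.normSq_nonneg z)
  | succ r ih =>
    rw [treeResolvent, Complex.inv_re, Complex.add_re, Complex.re_sum]
    exact div_nonneg (add_nonneg hz.le (Finset.sum_nonneg fun i _ => ih _))
      (Complex.normSq_nonneg _)

theorem re_le_re_add_sum_treeResolvent {z : ℂ} (hz : 0 < z.re) (r : ℕ) (k : List ℕ → ℕ) :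
    z.re ≤ (z + ∑ i ∈ Finset.range (k []), treeResolvent z r (subtree k i)).re := by
  rw [Complex.add_re, Complex.re_sum]
  exact le_add_of_nonneg_right (Finset.sum_nonneg fun i _ => treeResolvent_re_nonneg hz _ _)

theorem add_sum_treeResolvent_ne_zero {z : ℂ} (hz : 0 < z.re) (r : ℕ) (k : List ℕ → ℕ) :
    z + ∑ i ∈ Finset.range (k []), treeResolvent z r (subtree k i) ≠ 0 := by
  intro h
  have := re_le_re_add_sum_treeResolvent hz r k
  rw [h] at this
  exact absurd hz (not_lt.2 this)

theorem norm_treeResolvent_le {z : ℂ} (hz : 0 < z.re) (r : ℕ) (k : List ℕ → ℕ) :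
    ‖treeResolvent z r k‖ ≤ z.re⁻¹ := by
  cases r with
  | zero =>
    rw [treeResolvent, norm_inv]
    exact inv_anti₀ hz (Complex.re_le_norm z)
  | succ r =>
    rw [treeResolvent, norm_inv]
    exact inv_anti₀ hz ((re_le_re_add_sum_treeResolvent hz r k).trans (Complex.re_le_norm _))

theorem differentiableOn_treeResolvent (r : ℕ) (k : List ℕ → ℕ) :
    DifferentiableOn ℂ (fun z => treeResolvent z r k) {z | 0 < z.re} := by
  induction r generalizing k with
  | zero =>
    refine differentiableOn_id.inv fun z hz h => ?_
    change z = 0 at h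
    simp [h] at hz
  | succ r ih =>
    exact (differentiableOn_id.add (DifferentiableOn.fun_sum fun i _ => ih (subtree k i))).inv
      fun z hz => add_sum_treeResolvent_ne_zero hz r k

/-- A difference of inverses is the product of the inverses times the difference of the
denominators: each level gains `z.re⁻¹ ^ 2` and sums over the sons. -/
theorem norm_treeResolvent_succ_sub_le {z : ℂ} (hz : 0 < z.re) (r : ℕ) (k : List ℕ → ℕ) :
    ‖treeResolvent z (r + 1) k - treeResolvent z r k‖ ≤
      generationSize r k * (z.re⁻¹ ^ 2) ^ r * (2 * z.re⁻¹) := by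
  induction r generalizing k with
  | zero =>
    have h0 := norm_treeResolvent_le hz 0 k
    have h1 := norm_treeResolvent_le hz 1 k
    simp only [generationSize, Nat.cast_one, pow_zero, one_mul]
    exact (norm_sub_le _ _).trans (by linarith)
  | succ r ih =>
    have h0 := norm_treeResolvent_le hz (r + 1) k
    have h1 := norm_treeResolvent_le hz (r + 2) k
    have hinv : 0 ≤ z.re⁻¹ := (inv_pos.2 hz).le
    have heq : treeResolvent z (r + 2) k - treeResolvent z (r + 1) k =
        treeResolvent z (r + 2) k * treeResolvent z (r + 1) k *
          ∑ i ∈ Finset.range (k []),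
            (treeResolvent z r (subtree k i) - treeResolvent z (r + 1) (subtree k i)) := by
      have n0 := add_sum_treeResolvent_ne_zero hz r k
      have n1 := add_sum_treeResolvent_ne_zero hz (r + 1) k
      rw [treeResolvent, treeResolvent, inv_sub_inv n1 n0, Finset.sum_sub_distrib]
      field_simp
      ring
    have hsum : ‖∑ i ∈ Finset.range (k []),
        (treeResolvent z r (subtree k i) - treeResolvent z (r + 1) (subtree k i))‖ ≤
        generationSize (r + 1) k * (z.re⁻¹ ^ 2) ^ r * (2 * z.re⁻¹) := by
      rw [generationSize, Nat.cast_sum, Finset.sum_mul, Finset.sum_mul]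
      refine (norm_sum_le _ _).trans (Finset.sum_le_sum fun i _ => ?_)
      rw [norm_sub_rev]
      exact ih _
    rw [heq, norm_mul, norm_mul]
    calc _ ≤ z.re⁻¹ * z.re⁻¹ *
          (generationSize (r + 1) k * (z.re⁻¹ ^ 2) ^ r * (2 * z.re⁻¹)) := by gcongr
      _ = _ := by ring

/-- If the generations of the tree grow at most exponentially, the monomer probabilities converge
at all `x > 0`, to a real analytic function. -/
theorem exists_analyticAt_tendsto_treeRec {k : List ℕ → ℕ} {A : ℝ} (hA : 0 < A)
    (hk : Summable fun r => (generationSize r k : ℝ) * A⁻¹ ^ r) {x₀ : ℝ} (hx₀ : 0 < x₀) :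
    ∃ g : ℝ → ℝ, AnalyticAt ℝ g x₀ ∧
      ∀ᶠ x in 𝓝 x₀, Tendsto (fun r => treeRec x r k 1) atTop (𝓝 (g x)) := by
  set B := max 1 A with hB
  have hB1 : 1 ≤ B := le_max_left _ _
  have hBA : A ≤ B := le_max_right _ _
  -- The disc of radius `x₀ / 2 + B + 1` about `c` contains `x₀` and stays in `Re z ≥ x₀ / 2`. On
  -- the unit disc about `c`, `Re z ≥ B`; with `B ≥ 1` and `B ≥ A` this gives `(Re z)⁻² ≤ A⁻¹`.
  set c : ℂ := ((x₀ + B + 1 : ℝ) : ℂ) with hc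
  have hcre : c.re = x₀ + B + 1 := Complex.ofReal_re _
  have hre : ∀ z t, dist z c ≤ t → x₀ + B + 1 - t ≤ z.re := by
    intro z t hz
    have h1 := (Complex.abs_re_le_norm (z - c)).trans ((dist_eq_norm z c).symm.le.trans hz)
    rw [Complex.sub_re, hcre] at h1
    linarith [(abs_le.1 h1).1]
  have hball : ∀ z ∈ Metric.ball c (x₀ / 2 + B + 1), x₀ / 2 ≤ z.re := fun z hz => by
    linarith [hre z _ (Metric.mem_ball.1 hz).le]
  obtain ⟨F, hF, hlim⟩ := exists_analyticOnNhd_tendsto (f := fun r z => treeResolvent z r k)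
    (c := c) (s := 1) (R := x₀ / 2 + B + 1) (M := (x₀ / 2)⁻¹)
    (u := fun r => (generationSize r k : ℝ) * A⁻¹ ^ r * 2) one_pos (by linarith)
    (fun r => (differentiableOn_treeResolvent r k).mono fun z hz =>
      lt_of_lt_of_le (half_pos hx₀) (hball z hz))
    (fun r z hz => (norm_treeResolvent_le (lt_of_lt_of_le (half_pos hx₀) (hball z hz)) r k).trans
      (inv_anti₀ (half_pos hx₀) (hball z hz)))
    (hk.mul_right 2) (fun r z hz => by
      have h1 := hre z _ (Metric.mem_closedBall.1 hz)
      have h2 : B ≤ z.re := by linarith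
      have h3 : 0 < z.re := by linarith
      have h4 : z.re⁻¹ ≤ 1 := inv_le_one_of_one_le₀ (hB1.trans h2)
      have h5 : z.re⁻¹ ^ 2 ≤ A⁻¹ := by
        rw [inv_pow]
        exact inv_anti₀ hA (by nlinarith)
      refine (norm_treeResolvent_succ_sub_le h3 r k).trans ?_
      gcongr
      linarith)
  have hmem : ∀ᶠ x : ℝ in 𝓝 x₀, (x : ℂ) ∈ Metric.ball c (x₀ / 2 + B + 1) := by
    refine Complex.continuous_ofReal.continuousAt.eventually_mem (Metric.isOpen_ball.mem_nhds ?_)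
    rw [Metric.mem_ball, hc, Complex.dist_of_im_eq (by simp), Complex.ofReal_re, Complex.ofReal_re,
      Real.dist_eq, abs_lt]
    constructor <;> linarith
  refine ⟨fun x => ((x : ℂ) * F x).re, ?_, ?_⟩
  · have h1 : AnalyticAt ℝ (fun z : ℂ => z * F z) (x₀ : ℂ) :=
      (analyticAt_id.mul (hF _ hmem.self_of_nhds)).restrictScalars
    have h2 : AnalyticAt ℝ (fun x : ℝ => (x : ℂ)) x₀ := Complex.ofRealCLM.analyticAt x₀
    exact (Complex.reCLM.analyticAt _).comp (h1.comp_of_eq h2 rfl)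
  · filter_upwards [hmem, lt_mem_nhds hx₀] with x hx hx0
    have h1 := (Complex.continuous_re.tendsto _).comp ((hlim _ hx).const_mul (x : ℂ))
    refine h1.congr fun r => ?_
    simp only [Function.comp_apply, ← ofReal_treeRec hx0, Complex.ofReal_re]

end Resolvent

/-! ### The branching property of i.i.d. labelled trees. -/

section Branching

variable {E : Type*} [MeasurableSpace E]

@[fun_prop]
theorem measurable_subtree (i : ℕ) : Measurable fun w : List ℕ → E => subtree w i :=
  measurable_pi_lambda _ fun v => measurable_pi_apply (i :: v)

/-- The family of labels with root label `e`, and label `s (i, v)` at the vertex `i :: v`. -/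
def graft {α : Type*} (p : α × (ℕ × List ℕ → α)) : List ℕ → α
  | [] => p.1
  | i :: v => p.2 (i, v)

theorem measurable_graft : Measurable (graft : E × (ℕ × List ℕ → E) → List ℕ → E) := by
  refine measurable_pi_lambda _ fun v => ?_
  cases v with
  | nil => exact measurable_fst
  | cons i v => exact (measurable_pi_apply (i, v)).comp measurable_snd

/-- A nonempty word is `i :: v` for a unique pair `(i, v)`, so the product over words is the root
factor times a product over pairs. Finite cylinders suffice to check this. -/
theorem map_graft (μ : Measure E) [IsProbabilityMeasure μ] :
    (μ.prod (Measure.infinitePi fun _ : ℕ × List ℕ => μ)).map graft =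
      Measure.infinitePi fun _ : List ℕ => μ := by
  classical
  refine Measure.eq_infinitePi _ fun s t ht => ?_
  let c : ℕ × List ℕ → List ℕ := fun p => p.1 :: p.2
  have hc : Function.Injective c := fun p q h => by
    simp only [c, List.cons.injEq] at h
    exact Prod.ext h.1 h.2
  have hrange : ∀ v, v ∉ Set.range c ↔ v = [] := by
    rintro (_ | ⟨i, v⟩)
    · simp [c]
    · simp only [reduceCtorEq, iff_false, not_not]
      exact ⟨(i, v), rfl⟩
  have hpre : graft ⁻¹' (Set.pi s t) =
      (if [] ∈ s then t [] else univ) ×ˢ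
        Set.pi (s.preimage c hc.injOn) (fun p => t (c p)) := by
    ext ⟨e, w⟩
    simp only [mem_preimage, Set.mem_pi, Finset.mem_coe, Set.mem_prod, Finset.mem_preimage]
    constructor
    · intro h
      refine ⟨?_, fun p hp => h (c p) hp⟩
      split_ifs with h0
      exacts [h [] h0, mem_univ _]
    · rintro ⟨h1, h2⟩ v hv
      rcases v with _ | ⟨i, v⟩
      · rw [if_pos hv] at h1
        exact h1
      · exact h2 (i, v) hv
  rw [Measure.map_apply measurable_graft (.pi s.countable_toSet fun _ _ => ht _), hpre,
    Measure.prod_prod, Measure.infinitePi_pi _ fun p _ => ht _,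
    Finset.prod_preimage' c s hc.injOn fun v => μ (t v),
    ← Finset.prod_filter_not_mul_prod_filter s (· ∈ Set.range c)]
  congr 1
  simp_rw [hrange]
  split_ifs with h0
  · rw [show s.filter (· = []) = {[]} by ext v; simpa [h0] using fun hv : v = [] => hv ▸ h0]
    simp
  · rw [show s.filter (· = []) = ∅ from
      Finset.filter_eq_empty_iff.2 fun v hv h => h0 (h ▸ hv)]
    simp

/-- The branching property: the label of the root and the labelled subtrees hanging from the sons
of the root are independent, and these subtrees are distributed as the whole tree. -/
theorem map_root_subtrees (μ : Measure E) [IsProbabilityMeasure μ] :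
    (Measure.infinitePi fun _ : List ℕ => μ).map (fun w => (w [], fun i => subtree w i)) =
      μ.prod (Measure.infinitePi fun _ : ℕ => Measure.infinitePi fun _ : List ℕ => μ) := by
  have h := Measure.map_prod_map μ (Measure.infinitePi fun _ : ℕ × List ℕ => μ) measurable_id
    (MeasurableEquiv.curry ℕ (List ℕ) E).measurable
  rw [Measure.map_id, Measure.infinitePi_map_curry fun (_ : ℕ) (_ : List ℕ) => μ] at h
  -- After `graft`, taking the root label and the subtrees is just currying the second component,
  -- definitionally.
  rw [h, ← map_graft, Measure.map_map (by fun_prop) measurable_graft]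
  rfl

/-- The map `(n, s) ↦ x² / (x² + ∑_{i < n} s i)` of the distributional equation. -/
noncomputable def recursionMap (x : ℝ) (p : ℕ × (ℕ → ℝ)) : ℝ :=
  x ^ 2 / (x ^ 2 + ∑ i ∈ Finset.range p.1, p.2 i)

@[fun_prop]
theorem measurable_recursionMap (x : ℝ) : Measurable (recursionMap x) := by
  refine measurable_from_prod_countable_right fun n => ?_
  simp only [recursionMap]
  fun_prop

/-- If the value at the root is computed by the monomer recursion from the values `T` at the roots
of the subtrees, then its law is the image of the law of `T` by the distributional recursion. -/
theorem map_recursionMap_subtrees (μ : Measure E) [IsProbabilityMeasure μ] {ρ : PMF ℕ} {n : E → ℕ}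
    (hn : Measurable n) (hμ : μ.map n = ρ.toMeasure) (x : ℝ) {T : (List ℕ → E) → ℝ}
    (hT : Measurable T) :
    (Measure.infinitePi fun _ : List ℕ => μ).map
        (fun w => recursionMap x (n (w []), fun i => T (subtree w i))) =
      recursionLaw ρ x ((Measure.infinitePi fun _ : List ℕ => μ).map T) := by
  have h := Measure.infinitePi_map_pi (X := fun _ : ℕ => List ℕ → E) (Y := fun _ => ℝ)
    (fun _ : ℕ => Measure.infinitePi fun _ : List ℕ => μ) (f := fun _ => T) fun _ => hT
  have hT' : Measurable fun (s : ℕ → List ℕ → E) (i : ℕ) => T (s i) := by fun_prop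
  rw [recursionLaw, ← h, ← hμ, Measure.map_prod_map _ _ hn hT', ← map_root_subtrees,
    Measure.map_map (hn.prodMap hT') (by fun_prop)]
  have hroot : Measurable fun w : List ℕ → E => (w [], fun i => subtree w i) := by fun_prop
  exact (Measure.map_map (measurable_recursionMap x) ((hn.prodMap hT').comp hroot)).symm

theorem measurable_treeRec (x : ℝ) (r : ℕ) :
    Measurable fun p : (List ℕ → ℕ) × (List ℕ → ℝ) => treeRec x r p.1 p.2 := by
  induction r with
  | zero => exact (measurable_pi_apply []).comp measurable_snd
  | succ r ih =>
    have : Measurable fun p : (List ℕ → ℕ) × (List ℕ → ℝ) =>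
        (p.1 [], fun i => treeRec x r (subtree p.1 i) (subtree p.2 i)) := by
      refine ((measurable_pi_apply []).comp measurable_fst).prodMk
        (measurable_pi_lambda _ fun i => ?_)
      exact ih.comp (f := fun p : (List ℕ → ℕ) × (List ℕ → ℝ) => (subtree p.1 i, subtree p.2 i))
        (by fun_prop)
    exact (measurable_recursionMap x).comp this

end Branching

/-! ### Exponential growth of the generations. -/

section Growth

theorem measurable_sum_range {α : Type*} [MeasurableSpace α] {g : α → ℝ≥0∞} (hg : Measurable g) :
    Measurable fun p : ℕ × (ℕ → α) => ∑ i ∈ Finset.range p.1, g (p.2 i) := by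
  refine measurable_from_prod_countable_right fun n => ?_
  simp only
  fun_prop

theorem measurable_generationSize (r : ℕ) :
    Measurable fun k : List ℕ → ℕ => (generationSize r k : ℝ≥0∞) := by
  induction r with
  | zero => simp [generationSize]
  | succ r ih =>
    simp only [generationSize, Nat.cast_sum]
    exact (measurable_sum_range ih).comp
      (f := fun k : List ℕ → ℕ => (k [], fun i => subtree k i)) (by fun_prop)

/-- Conditionally on `n` sons of the root, generation `r + 1` is a sum of `n` copies of generation
`r`; averaging over `n` gives one more factor of the mean. -/
theorem lintegral_generationSize (ρ : PMF ℕ) (r : ℕ) :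
    ∫⁻ k, (generationSize r k : ℝ≥0∞) ∂(Measure.infinitePi fun _ : List ℕ => ρ.toMeasure) =
      (∑' k : ℕ, (k : ℝ≥0∞) * ρ k) ^ r := by
  induction r with
  | zero => simp [generationSize]
  | succ r ih =>
    simp only [generationSize, Nat.cast_sum]
    have hm := measurable_sum_range (measurable_generationSize r)
    have h := lintegral_map (μ := Measure.infinitePi fun _ : List ℕ => ρ.toMeasure) hm
      (g := fun k : List ℕ → ℕ => (k [], fun i => subtree k i)) (by fun_prop)
    rw [← h, map_root_subtrees, lintegral_prod _ hm.aemeasurable]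
    have inner : ∀ n : ℕ, ∫⁻ s, ∑ i ∈ Finset.range n, (generationSize r (s i) : ℝ≥0∞)
        ∂(Measure.infinitePi fun _ : ℕ => Measure.infinitePi fun _ : List ℕ => ρ.toMeasure) =
        n * (∑' k : ℕ, (k : ℝ≥0∞) * ρ k) ^ r := by
      intro n
      rw [lintegral_finsetSum (f := fun i (s : ℕ → List ℕ → ℕ) => (generationSize r (s i) : ℝ≥0∞))
        _ fun i _ => (measurable_generationSize r).comp (measurable_pi_apply i)]
      have : ∀ i : ℕ, ∫⁻ s, (generationSize r (s i) : ℝ≥0∞)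
          ∂(Measure.infinitePi fun _ : ℕ => Measure.infinitePi fun _ : List ℕ => ρ.toMeasure) =
          (∑' k : ℕ, (k : ℝ≥0∞) * ρ k) ^ r := by
        intro i
        rw [← ih, (measurePreserving_eval_infinitePi (fun _ : ℕ => Measure.infinitePi
          fun _ : List ℕ => ρ.toMeasure) i).lintegral_comp (measurable_generationSize r)]
      simp [this]
    simp_rw [inner]
    rw [lintegral_mul_const _ (by fun_prop), lintegral_countable', pow_succ, mul_comm]
    simp [PMF.toMeasure_apply_singleton]

/-- The generations of the tree grow at most exponentially. -/
def HasExponentialGrowth (k : List ℕ → ℕ) : Prop :=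
  ∃ A : ℝ, 0 < A ∧ Summable fun r => (generationSize r k : ℝ) * A⁻¹ ^ r

/-- Generation `r` of a son's subtree lies in generation `r + 1` of the tree. Being deterministic,
this passes the limit to the sons without a new null set. -/
theorem HasExponentialGrowth.subtree {k : List ℕ → ℕ} (hk : HasExponentialGrowth k) {i : ℕ}
    (hi : i < k []) : HasExponentialGrowth (subtree k i) := by
  obtain ⟨A, hA, h⟩ := hk
  refine ⟨A, hA, Summable.of_nonneg_of_le (fun r => by positivity) (fun r => ?_)
    (((summable_nat_add_iff 1).2 h).mul_left A)⟩
  have : generationSize r (MonomerDimer.subtree k i) ≤ generationSize (r + 1) k :=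
    Finset.single_le_sum (f := fun i => generationSize r (MonomerDimer.subtree k i))
      (fun _ _ => Nat.zero_le _) (Finset.mem_range.2 hi)
  calc (generationSize r (MonomerDimer.subtree k i) : ℝ) * A⁻¹ ^ r
      ≤ generationSize (r + 1) k * A⁻¹ ^ r := by gcongr
    _ = A * (generationSize (r + 1) k * A⁻¹ ^ (r + 1)) := by
      rw [pow_succ]
      field_simp

theorem ae_hasExponentialGrowth {ρ : PMF ℕ} (hρ : ∑' k : ℕ, (k : ℝ≥0∞) * ρ k < ∞) :
    ∀ᵐ k ∂(Measure.infinitePi fun _ : List ℕ => ρ.toMeasure), HasExponentialGrowth k := by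
  set m := ∑' k : ℕ, (k : ℝ≥0∞) * ρ k with hm
  -- Any rate above the mean works: the expected series is then geometric of ratio `m / A < 1`.
  -- Adding `1` also keeps `A` positive when the mean is `0`.
  set A : ℝ := m.toReal + 1 with hA
  have hA0 : 0 < A := by positivity
  set q := ENNReal.ofReal A⁻¹ with hq
  have hmq : m * q < 1 := by
    rw [← ENNReal.ofReal_toReal hρ.ne, hq, ← ENNReal.ofReal_mul ENNReal.toReal_nonneg,
      ENNReal.ofReal_lt_one, ← div_eq_mul_inv, div_lt_one hA0]
    exact lt_add_one _
  have hmeas : ∀ r, Measurable fun k : List ℕ → ℕ => (generationSize r k : ℝ≥0∞) * q ^ r :=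
    fun r => (measurable_generationSize r).mul_const _
  have hint : ∫⁻ k, ∑' r, (generationSize r k : ℝ≥0∞) * q ^ r
      ∂(Measure.infinitePi fun _ : List ℕ => ρ.toMeasure) ≠ ∞ := by
    rw [lintegral_tsum fun r => (hmeas r).aemeasurable]
    simp_rw [fun r => lintegral_mul_const (μ := Measure.infinitePi fun _ : List ℕ => ρ.toMeasure)
      (q ^ r) (measurable_generationSize r), lintegral_generationSize, ← mul_pow]
    rw [ENNReal.tsum_geometric]
    exact ENNReal.inv_ne_top.2 (tsub_pos_of_lt hmq).ne'
  filter_upwards [ae_lt_top (Measurable.tsum hmeas) hint] with k hk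
  refine ⟨A, hA0, (ENNReal.summable_toReal hk.ne).congr fun r => ?_⟩
  simp [hq, hA0.le]

end Growth

/-! ### The limit, its fixed point equation and uniqueness. -/

section Limit

/-- The limit of the monomer probabilities at the root of the truncated trees. -/
noncomputable def monomerLimit (x : ℝ) (k : List ℕ → ℕ) : ℝ :=
  limsup (fun r => treeRec x r k 1) atTop

-- Using `limsup` keeps the definition total, hence measurable on all trees, including those where
-- convergence is not known.
@[fun_prop]
theorem measurable_monomerLimit (x : ℝ) : Measurable (monomerLimit x) :=
  Measurable.limsup fun r => (measurable_treeRec x r).comp (measurable_id.prodMk measurable_const)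

theorem HasExponentialGrowth.tendsto_treeRec {k : List ℕ → ℕ} (hk : HasExponentialGrowth k)
    {x : ℝ} (hx : 0 < x) :
    Tendsto (fun r => treeRec x r k 1) atTop (𝓝 (monomerLimit x k)) := by
  obtain ⟨A, hA, h⟩ := hk
  obtain ⟨g, -, hg⟩ := exists_analyticAt_tendsto_treeRec hA h hx
  have := hg.self_of_nhds
  rwa [monomerLimit, this.limsup_eq]

theorem HasExponentialGrowth.analyticOnNhd_monomerLimit {k : List ℕ → ℕ}
    (hk : HasExponentialGrowth k) : AnalyticOnNhd ℝ (fun x => monomerLimit x k) (Ioi 0) := by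
  obtain ⟨A, hA, h⟩ := hk
  intro x hx
  obtain ⟨g, hga, hg⟩ := exists_analyticAt_tendsto_treeRec hA h hx
  exact hga.congr (hg.mono fun y hy => hy.limsup_eq.symm)

theorem HasExponentialGrowth.monomerLimit_mem_Icc {k : List ℕ → ℕ} (hk : HasExponentialGrowth k)
    {x : ℝ} (hx : 0 < x) : monomerLimit x k ∈ Icc (0 : ℝ) 1 :=
  isClosed_Icc.mem_of_tendsto (hk.tendsto_treeRec hx)
    (Eventually.of_forall fun r => treeRec_one_mem_Icc r k)

/-- The recursion at depth `r + 1` passes to the limit, its finite sum converging term by term and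
its denominator staying away from `0`. -/
theorem HasExponentialGrowth.monomerLimit_eq {k : List ℕ → ℕ} (hk : HasExponentialGrowth k)
    {x : ℝ} (hx : 0 < x) :
    monomerLimit x k = recursionMap x (k [], fun i => monomerLimit x (MonomerDimer.subtree k i)) := by
  refine tendsto_nhds_unique ((tendsto_add_atTop_iff_nat 1).2 (hk.tendsto_treeRec hx)) ?_
  have hsum : Tendsto (fun r => ∑ i ∈ Finset.range (k []),
      treeRec x r (MonomerDimer.subtree k i) 1) atTop
      (𝓝 (∑ i ∈ Finset.range (k []), monomerLimit x (MonomerDimer.subtree k i))) :=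
    tendsto_finsetSum _ fun i hi => (hk.subtree (Finset.mem_range.1 hi)).tendsto_treeRec hx
  have hnonneg : 0 ≤ ∑ i ∈ Finset.range (k []), monomerLimit x (MonomerDimer.subtree k i) :=
    Finset.sum_nonneg fun i hi =>
      ((hk.subtree (Finset.mem_range.1 hi)).monomerLimit_mem_Icc hx).1
  exact tendsto_const_nhds.div (hsum.const_add (x ^ 2)) (by positivity)

theorem isFixedPointLaw_map_monomerLimit {ρ : PMF ℕ} (hρ : ∑' k : ℕ, (k : ℝ≥0∞) * ρ k < ∞) {x : ℝ}
    (hx : 0 < x) :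
    IsFixedPointLaw ρ x
      ((Measure.infinitePi fun _ : List ℕ => ρ.toMeasure).map (monomerLimit x)) where
  isProbabilityMeasure := Measure.isProbabilityMeasure_map (measurable_monomerLimit x).aemeasurable
  supported := by
    refine (ae_map_iff (measurable_monomerLimit x).aemeasurable measurableSet_Icc).2 ?_
    filter_upwards [ae_hasExponentialGrowth hρ] with k hk using hk.monomerLimit_mem_Icc hx
  fixed := by
    rw [← map_recursionMap_subtrees ρ.toMeasure measurable_id Measure.map_id x
      (measurable_monomerLimit x)]
    refine Measure.map_congr ?_
    filter_upwards [ae_hasExponentialGrowth hρ] with k hk using hk.monomerLimit_eq hx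

/-- The value at the root when the vertex `v` has `(w v).1` sons, and the generation `r` has the
boundary values `(w v).2`, truncated to `[0, 1]`. -/
noncomputable def markedTreeRec (x : ℝ) (r : ℕ) (w : List ℕ → ℕ × ℝ) : ℝ :=
  treeRec x r (fun v => (w v).1) (fun v => max 0 (min 1 (w v).2))

theorem measurable_markedTreeRec (x : ℝ) (r : ℕ) : Measurable (markedTreeRec x r) :=
  (measurable_treeRec x r).comp
    (f := fun w : List ℕ → ℕ × ℝ => (fun v => (w v).1, fun v => max 0 (min 1 (w v).2)))
    (by fun_prop)

/-- A fixed point law is preserved by putting it on the boundary of a truncated random tree. -/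
theorem IsFixedPointLaw.map_markedTreeRec {ρ : PMF ℕ} {x : ℝ} {ν : Measure ℝ}
    (hν : IsFixedPointLaw ρ x ν) (r : ℕ) :
    (Measure.infinitePi fun _ : List ℕ => ρ.toMeasure.prod ν).map (markedTreeRec x r) = ν := by
  have := hν.isProbabilityMeasure
  induction r with
  | zero =>
    -- At depth `0` the value is the truncated mark of the root. The truncation serves to make the
    -- sandwich hold for every `w`; it is the identity `ν`-almost everywhere.
    have h0 : (markedTreeRec x 0) =
        (fun y : ℝ => max 0 (min 1 y)) ∘ Prod.snd ∘ fun w : List ℕ → ℕ × ℝ => w [] := rfl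
    rw [h0, ← Measure.map_map (by fun_prop) (by fun_prop),
      ← Measure.map_map (by fun_prop) (by fun_prop), Measure.infinitePi_map_eval,
      Measure.map_snd_prod, measure_univ, one_smul]
    conv_rhs => rw [← Measure.map_id (μ := ν)]
    refine Measure.map_congr ?_
    filter_upwards [hν.supported] with y hy
    simp [hy.1, hy.2]
  | succ r ih =>
    have h := map_recursionMap_subtrees (ρ.toMeasure.prod ν) (ρ := ρ) measurable_fst
      (by simp [Measure.map_fst_prod]) x (measurable_markedTreeRec x r)
    rw [ih, ← hν.fixed] at h
    exact h

theorem tendsto_markedTreeRec {x : ℝ} (hx : 0 < x) {w : List ℕ → ℕ × ℝ}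
    (hw : HasExponentialGrowth fun v => (w v).1) :
    Tendsto (fun r => markedTreeRec x (r + 1) w) atTop
      (𝓝 (monomerLimit x fun v => (w v).1)) := by
  have h0 := hw.tendsto_treeRec hx
  have h1 := (tendsto_add_atTop_iff_nat 1).2 h0
  have hmem := fun r => treeRec_mem_uIcc hx r (fun v => (w v).1)
    (y := fun v => max 0 (min 1 (w v).2)) (fun v => le_max_left _ _)
    (fun v => max_le zero_le_one (min_le_left _ _))
  have hmin := h0.min h1
  have hmax := h0.max h1
  rw [min_self] at hmin
  rw [max_self] at hmax
  exact tendsto_of_tendsto_of_tendsto_of_le_of_le hmin hmax (fun r => (hmem r).1)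
    fun r => (hmem r).2

theorem IsFixedPointLaw.eq_map_monomerLimit {ρ : PMF ℕ}
    (hρ : ∑' k : ℕ, (k : ℝ≥0∞) * ρ k < ∞) {x : ℝ} (hx : 0 < x) {ν : Measure ℝ}
    (hν : IsFixedPointLaw ρ x ν) :
    ν = (Measure.infinitePi fun _ : List ℕ => ρ.toMeasure).map (monomerLimit x) := by
  have := hν.isProbabilityMeasure
  have hL := measurable_monomerLimit x
  have := Measure.isProbabilityMeasure_map
    (μ := Measure.infinitePi fun _ : List ℕ => ρ.toMeasure) hL.aemeasurable
  set Q := Measure.infinitePi fun _ : List ℕ => ρ.toMeasure.prod ν with hQ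
  have hfst : Measurable fun (w : List ℕ → ℕ × ℝ) (v : List ℕ) => (w v).1 := by fun_prop
  have hmap : Q.map (fun w v => (w v).1) = Measure.infinitePi fun _ : List ℕ => ρ.toMeasure := by
    rw [hQ, Measure.infinitePi_map_pi (X := fun _ : List ℕ => ℕ × ℝ) (Y := fun _ => ℕ)
      (fun _ => ρ.toMeasure.prod ν) (f := fun _ => Prod.fst) fun _ => measurable_fst]
    simp [Measure.map_fst_prod]
  have hgrowth : ∀ᵐ w ∂Q, HasExponentialGrowth fun v => (w v).1 :=
    ae_of_ae_map hfst.aemeasurable (hmap ▸ ae_hasExponentialGrowth hρ)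
  refine ext_of_forall_integral_eq_of_IsFiniteMeasure fun f => ?_
  have hf := f.continuous.stronglyMeasurable
  -- These integrals do not depend on `r`, while dominated convergence sends them to the integral
  -- against the law of the limit.
  have hleft : ∀ r, ∫ w, f (markedTreeRec x (r + 1) w) ∂Q = ∫ y, f y ∂ν := by
    intro r
    rw [← integral_map (measurable_markedTreeRec x (r + 1)).aemeasurable hf.aestronglyMeasurable,
      hν.map_markedTreeRec]
  have hright : ∫ w, f (monomerLimit x fun v => (w v).1) ∂Q =
      ∫ y, f y ∂((Measure.infinitePi fun _ : List ℕ => ρ.toMeasure).map (monomerLimit x)) := by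
    rw [← hmap, Measure.map_map hL hfst,
      integral_map (hL.comp hfst).aemeasurable hf.aestronglyMeasurable]
    rfl
  have hlim : Tendsto (fun r => ∫ w, f (markedTreeRec x (r + 1) w) ∂Q) atTop
      (𝓝 (∫ w, f (monomerLimit x fun v => (w v).1) ∂Q)) := by
    refine tendsto_integral_of_dominated_convergence (fun _ => ‖f‖)
      (fun r => (hf.comp_measurable (measurable_markedTreeRec x (r + 1))).aestronglyMeasurable)
      (integrable_const _) (fun r => Eventually.of_forall fun w => f.norm_coe_le_norm _) ?_
    filter_upwards [hgrowth] with w hw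
    exact (f.continuous.tendsto _).comp (tendsto_markedTreeRec hx hw)
  simp_rw [hleft] at hlim
  rw [← hright]
  exact tendsto_nhds_unique tendsto_const_nhds hlim

end Limit

end MonomerDimer

/-! ### Transfer from the product measure to the given probability space. -/

theorem mainTheorem3 {Ω : Type*} [MeasurableSpace Ω] (P : Measure Ω) [IsProbabilityMeasure P]
    (ρ : PMF ℕ) (hρ : ∑' k : ℕ, (k : ℝ≥0∞) * ρ k < ∞)
    (K : List ℕ → Ω → ℕ) (hK : MonomerDimer.IsGaltonWatsonOffspring P ρ K) :
    ∃ X : ℝ → Ω → ℝ,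
      (∀ x : ℝ, 0 < x → Measurable (X x)) ∧
      (∀ᵐ ω ∂P, ∀ x : ℝ, 0 < x →
        Tendsto
          (fun r : ℕ => MonomerDimer.monomerProb
            (MonomerDimer.truncatedTree (fun v => K v ω) r) x
            (MonomerDimer.treeRoot (fun v => K v ω) r))
          atTop (𝓝 (X x ω))) ∧
      (∀ᵐ ω ∂P, AnalyticOnNhd ℝ (fun x : ℝ => X x ω) (Ioi 0)) ∧
      ∀ x : ℝ, 0 < x →
        MonomerDimer.IsFixedPointLaw ρ x (P.map (X x)) ∧
        ∀ ν : Measure ℝ, MonomerDimer.IsFixedPointLaw ρ x ν → ν = P.map (X x) := by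
  have hmeas : Measurable fun ω v => K v ω := measurable_pi_lambda _ hK.measurable
  -- Independence and the common law identify the law of the whole offspring family, so almost sure
  -- statements and laws can be pulled back from the product space.
  have hlaw : P.map (fun ω v => K v ω) = Measure.infinitePi fun _ : List ℕ => ρ.toMeasure := by
    rw [hK.indep.map_fun_eq_infinitePi_map hK.measurable]
    simp_rw [hK.law]
  have hgrowth : ∀ᵐ ω ∂P, MonomerDimer.HasExponentialGrowth fun v => K v ω :=
    ae_of_ae_map hmeas.aemeasurable (hlaw ▸ MonomerDimer.ae_hasExponentialGrowth hρ)
  have hX : ∀ x, P.map (fun ω => MonomerDimer.monomerLimit x fun v => K v ω) =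
      (Measure.infinitePi fun _ : List ℕ => ρ.toMeasure).map (MonomerDimer.monomerLimit x) := by
    intro x
    rw [← hlaw, Measure.map_map (MonomerDimer.measurable_monomerLimit x) hmeas]
    rfl
  refine ⟨fun x ω => MonomerDimer.monomerLimit x fun v => K v ω,
    fun x _ => (MonomerDimer.measurable_monomerLimit x).comp hmeas, ?_, ?_, fun x hx => ?_⟩
  · filter_upwards [hgrowth] with ω hω x hx
    simp_rw [MonomerDimer.monomerProb_truncatedTree hx, MonomerDimer.monomerRatio_treeFinset hx]
    exact hω.tendsto_treeRec hx
  · filter_upwards [hgrowth] with ω hω using hω.analyticOnNhd_monomerLimit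
  · rw [hX]
    exact ⟨MonomerDimer.isFixedPointLaw_map_monomerLimit hρ hx,
      fun ν hν => hν.eq_map_monomerLimit hρ hx⟩
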